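/- For complex $z,s$ with $\operatorname{Re} z>0$, $\operatorname{Re} s>0$ let $$\beta(z,s)=\frac1{\Gamma(s)}\int_0^\infty \frac{x^{s-1}}{\cosh^{z}x}\,dx$$ be the generalized Dirichlet beta function (the integral converges absolutely). Let $\mathcal A=x^2-x\frac{d}{dx}x\frac{d}{dx}$ and, for $n\in\mathbb N_0$, $\operatorname{Re}\alpha>-\tfrac12$, $x>0$, let $$p_n(x;\alpha)=(-1)^n e^{x}x^{-\alpha}\mathcal A^n\bigl(e^{-x}x^{\alpha}\bigr).$$ For $\alpha\ne 0$ one has $p_n(x;\alpha)=\sum_{k=0}^n c_{n,k}(\alpha)x^k$ with $$c_{n,k}(\alpha)=\frac{2^{k+1}}{k!}\Bigl(\alpha+\tfrac12\Bigr)_k\sum_{\mu=0}^k\binom k\mu\frac{(-1)^\mu\,\Gamma(2\alpha+\mu)}{\Gamma(2\alpha+\mu+k+1)}(\alpha+\mu)^{2n+1},$$ where $(a)_k=a(a+1)\cdots(a+k-1)$ is the Pochhammer symbol. Theorem. Let $n\in\mathbb N_0$. The function $\beta(z,s)$ has a holomorphic continuation in $(z,s)$ to the domain $\operatorname{Re}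 z>0$, $\operatorname{Re} s>-2n$, and this continuation, still denoted $\beta$, satisfies $$\sum_{k=0}^n\frac{(z/2)_k}{2^k}\,c_{n,k}\!\left(\frac z2\right)\beta(z+2k,\,s+2n)=4^{-n}\beta(z,s),\qquad \operatorname{Re} z>0,\ \operatorname{Re} s>-2n .$$ -/

import Mathlib

open MeasureTheory Set

noncomputable section

/-- The integrand `x^(s-1) / cosh^z x` of the generalized Dirichlet beta function. -/
def betaIntegrand (z s : ℂ) (x : ℝ) : ℂ :=
  (x : ℂ) ^ (s - 1) / ((Real.cosh x : ℝ) : ℂ) ^ z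

/-- `Γ(s)⁻¹ ∫₀^∞ x^(s-1) / cosh^z x dx`, meaningful for `Re z > 0`, `Re s > 0`. -/
def betaIntegral (z s : ℂ) : ℂ :=
  (Complex.Gamma s)⁻¹ * ∫ x in Ioi (0 : ℝ), betaIntegrand z s x

/-- The domain `Re z > 0`, `Re s > -2n` in `ℂ × ℂ`. -/
def betaDomain (n : ℕ) : Set (ℂ × ℂ) :=
  {p | 0 < p.1.re ∧ -2 * (n : ℝ) < p.2.re}

/-- `β` is the holomorphic continuation (in both variables) of the generalized Dirichlet beta
function from `Re z > 0`, `Re s > 0` to `Re z > 0`, `Re s > -2n`. -/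
def IsBetaContinuation (n : ℕ) (β : ℂ → ℂ → ℂ) : Prop :=
  DifferentiableOn ℂ (fun p : ℂ × ℂ => β p.1 p.2) (betaDomain n) ∧
    ∀ z s : ℂ, 0 < z.re → 0 < s.re → β z s = betaIntegral z s

/-- The second order Bessel operator `x² - x (d/dx) x (d/dx)`. -/
def besselOp (f : ℝ → ℂ) (x : ℝ) : ℂ :=
  (x : ℂ) ^ 2 * f x - (x : ℂ) * deriv (fun y : ℝ => (y : ℂ) * deriv f y) x

/-- `p_n(x; α) = (-1)^n e^x x^(-α) 𝒜^n (e^(-x) x^α)`, where `𝒜` is the Bessel operator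
(a function on `x > 0`). -/
def besselP (n : ℕ) (α : ℂ) (x : ℝ) : ℂ :=
  (-1) ^ n * Complex.exp (x : ℂ) * (x : ℂ) ^ (-α) *
    (besselOp^[n] (fun y : ℝ => Complex.exp (-(y : ℂ)) * (y : ℂ) ^ α)) x

/-- The Pochhammer symbol `(a)_k = a (a+1) ⋯ (a+k-1)`. -/
def poch (a : ℂ) (k : ℕ) : ℂ := (ascPochhammer ℂ k).eval a

/-- The explicit coefficient `c_{n,k}(α)` of `x^k` in `p_n(x; α)`. -/
def besselCoeff (n k : ℕ) (α : ℂ) : ℂ :=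
  (2 : ℂ) ^ (k + 1) / (k.factorial : ℂ) * poch (α + 1 / 2) k *
    ∑ μ ∈ Finset.range (k + 1),
      (k.choose μ : ℂ) *
        ((-1) ^ μ * Complex.Gamma (2 * α + μ) / Complex.Gamma (2 * α + μ + k + 1)) *
        (α + μ) ^ (2 * n + 1)

end

open Filter Topology

/-! The same three-term recursion governs the coefficients, the Bessel operator and the beta
function. With g = cosh^(-z), g'' = z² g - z(z+1) cosh^(-z-2), so two integrations by parts give
β(z,s) = z² β(z,s+2) - z(z+1) β(z+2,s+2) (`betaIntegral_recurrence`). Iterating this defines the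
continuation, and the identity theorem makes it unique.

Put α = z/2 and w_k(s) = (α)_k 2^(-k) β(z+2k,s). The relation becomes w_k(s)/4 = (α+k)² w_k(s+2) -
(2α+2k+1) w_{k+1}(s+2). Passing from c_{n,k} to c_{n+1,k} applies exactly this right-hand side to
any weights (`sum_besselCoeff_succ`), so each step in n yields one factor 1/4. The same weighted-sum
lemma with weights e^(-x) x^(α+k) identifies c_{n,k} as the coefficients of p_n. -/

/-! ### Recursion for the explicit coefficients. -/

theorem two_mul_add_nat_ne_zero {α : ℂ} (hα : -(1 / 2 : ℝ) < α.re) (hα0 : α ≠ 0) (m : ℕ) :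
    2 * α + (m : ℂ) ≠ 0 := by
  rcases m with _ | m
  · simpa using hα0
  · intro h
    have h' := congrArg Complex.re h
    simp at h'
    have : (0 : ℝ) ≤ m := m.cast_nonneg
    linarith

theorem Gamma_two_mul_add_nat_ne_zero {α : ℂ} (hα : -(1 / 2 : ℝ) < α.re) (hα0 : α ≠ 0) (m : ℕ) :
    Complex.Gamma (2 * α + m) ≠ 0 := by
  refine Complex.Gamma_ne_zero fun j h => two_mul_add_nat_ne_zero hα hα0 (m + j) ?_
  push_cast
  linear_combination h

theorem Gamma_two_mul_add_nat_succ {α : ℂ} (hα : -(1 / 2 : ℝ) < α.re) (hα0 : α ≠ 0) (m : ℕ) :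
    Complex.Gamma (2 * α + (m + 1 : ℕ)) = (2 * α + m) * Complex.Gamma (2 * α + m) := by
  rw [← Complex.Gamma_add_one _ (two_mul_add_nat_ne_zero hα hα0 m)]
  push_cast
  ring_nf

theorem poch_succ (a : ℂ) (k : ℕ) : poch a (k + 1) = poch a k * (a + k) := by
  simp [poch, ascPochhammer_succ_eval]

/-- The alternating sum in the definition of `besselCoeff`. -/
noncomputable def besselSum (n k : ℕ) (α : ℂ) : ℂ :=
  ∑ μ ∈ Finset.range (k + 1),
    (k.choose μ : ℂ) *
      ((-1) ^ μ * Complex.Gamma (2 * α + μ) / Complex.Gamma (2 * α + μ + k + 1)) *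
      (α + μ) ^ (2 * n + 1)

theorem besselCoeff_eq (n k : ℕ) (α : ℂ) :
    besselCoeff n k α =
      (2 : ℂ) ^ (k + 1) / (k.factorial : ℂ) * poch (α + 1 / 2) k * besselSum n k α := rfl

theorem choose_succ_mul_sub (k μ : ℕ) (h : μ ≤ k + 1) :
    ((k + 1).choose μ : ℂ) * ((k : ℂ) + 1 - μ) = (k + 1) * (k.choose μ : ℂ) := by
  have h1 := Nat.choose_mul_succ_eq k μ
  have h2 : ((k.choose μ * (k + 1) : ℕ) : ℂ) = (((k + 1).choose μ * (k + 1 - μ) : ℕ) : ℂ) := by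
    rw [h1]
  push_cast [Nat.cast_sub h] at h2
  linear_combination -h2

/-- Termwise: (α+μ)² = (α+k+1)² - (k+1-μ)(2α+μ+k+1). The first factor of the last product turns
`(k+1).choose μ` into `(k+1) * k.choose μ`, the second lowers the Gamma argument in the denominator.
-/
theorem besselSum_succ {α : ℂ} (hα : -(1 / 2 : ℝ) < α.re) (hα0 : α ≠ 0) (n k : ℕ) :
    besselSum (n + 1) (k + 1) α =
      (α + k + 1) ^ 2 * besselSum n (k + 1) α - (k + 1) * besselSum n k α := by
  -- The extra term μ = k + 1 vanishes because its binomial coefficient does.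
  have hk : besselSum n k α = ∑ μ ∈ Finset.range (k + 1 + 1),
      (k.choose μ : ℂ) *
      ((-1) ^ μ * Complex.Gamma (2 * α + μ) / Complex.Gamma (2 * α + μ + k + 1)) *
      (α + μ) ^ (2 * n + 1) := by
    rw [Finset.sum_range_succ _ (k + 1)]
    simp [besselSum]
  rw [hk]
  unfold besselSum
  rw [Finset.mul_sum, Finset.mul_sum, ← Finset.sum_sub_distrib]
  refine Finset.sum_congr rfl fun μ hμ => ?_
  have hμ' : μ ≤ k + 1 := Nat.lt_succ_iff.1 (Finset.mem_range.1 hμ)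
  have hG := Gamma_two_mul_add_nat_succ hα hα0 (μ + k + 1)
  have h0 := two_mul_add_nat_ne_zero hα hα0 (μ + k + 1)
  have hG0 := Gamma_two_mul_add_nat_ne_zero hα hα0 (μ + k + 1)
  have hc := choose_succ_mul_sub k μ hμ'
  push_cast at hG h0 hG0 ⊢
  rw [show 2 * α + (μ : ℂ) + (k + 1) + 1 = 2 * α + (μ + k + 1 + 1) by ring,
    show 2 * α + (μ : ℂ) + k + 1 = 2 * α + (μ + k + 1) by ring, hG]
  field_simp
  linear_combination (-(2 * α + (μ + k + 1)) * Complex.Gamma (2 * α + μ) *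
    (α + μ) ^ (2 * n + 1)) * hc

/-- The summand telescopes: `G` is an explicit antidifference, zero at μ = 0 by its factor μ and at
μ = k + 2 by its binomial coefficient. -/
theorem besselSum_zero_succ {α : ℂ} (hα : -(1 / 2 : ℝ) < α.re) (hα0 : α ≠ 0) (k : ℕ) :
    besselSum 0 (k + 1) α = 0 := by
  let G : ℕ → ℂ := fun μ => -(1 / 2) * (-1) ^ μ * ((k + 1).choose μ : ℂ) * μ / (k + 1) *
    (Complex.Gamma (2 * α + μ) / Complex.Gamma (2 * α + (μ + k + 1 : ℕ)))
  have hG : besselSum 0 (k + 1) α = ∑ μ ∈ Finset.range (k + 1 + 1), (G (μ + 1) - G μ) := by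
    refine Finset.sum_congr rfl fun μ hμ => ?_
    have hμ' : μ ≤ k + 1 := Nat.lt_succ_iff.1 (Finset.mem_range.1 hμ)
    have hG1 := Gamma_two_mul_add_nat_succ hα hα0 μ
    have hG2 := Gamma_two_mul_add_nat_succ hα hα0 (μ + k + 1)
    have h0 := two_mul_add_nat_ne_zero hα hα0 (μ + k + 1)
    have hG0 := Gamma_two_mul_add_nat_ne_zero hα hα0 (μ + k + 1)
    have hk : (k : ℂ) + 1 ≠ 0 := by exact_mod_cast k.succ_ne_zero
    have hc : ((k + 1).choose (μ + 1) : ℂ) * (μ + 1) =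
        ((k + 1).choose μ : ℂ) * ((k : ℂ) + 1 - μ) := by
      have h2 : (((k + 1).choose (μ + 1) * (μ + 1) : ℕ) : ℂ) =
        (((k + 1).choose μ * (k + 1 - μ) : ℕ) : ℂ) := by rw [Nat.choose_succ_right_eq]
      push_cast [Nat.cast_sub hμ'] at h2
      exact h2
    simp only [G]
    rw [show μ + 1 + k + 1 = μ + k + 1 + 1 by ring, hG1, hG2]
    push_cast at h0 hG0 hG2 ⊢
    rw [show 2 * α + (μ : ℂ) + (k + 1) + 1 = 2 * α + (μ + k + 1 + 1) by ring, hG2]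
    rw [show -(1 / 2) * (-1) ^ (μ + 1) * ((k + 1).choose (μ + 1) : ℂ) * ((μ : ℂ) + 1) =
      -(1 / 2) * (-1) ^ (μ + 1) * (((k + 1).choose (μ + 1) : ℂ) * ((μ : ℂ) + 1)) by ring, hc]
    field_simp
    ring
  rw [hG, Finset.sum_range_sub]
  simp [G]

theorem besselCoeff_succ_zero (n : ℕ) (α : ℂ) :
    besselCoeff (n + 1) 0 α = α ^ 2 * besselCoeff n 0 α := by
  simp [besselCoeff]
  ring

theorem besselCoeff_succ_succ {α : ℂ} (hα : -(1 / 2 : ℝ) < α.re) (hα0 : α ≠ 0) (n k : ℕ) :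
    besselCoeff (n + 1) (k + 1) α =
      (α + k + 1) ^ 2 * besselCoeff n (k + 1) α - (2 * α + 2 * k + 1) * besselCoeff n k α := by
  have hk : (k : ℂ) + 1 ≠ 0 := by exact_mod_cast k.succ_ne_zero
  have hf : (k.factorial : ℂ) ≠ 0 := by exact_mod_cast k.factorial_ne_zero
  simp only [besselCoeff_eq, besselSum_succ hα hα0, poch_succ, Nat.factorial_succ]
  push_cast
  field_simp
  ring

theorem besselCoeff_zero_zero {α : ℂ} (hα0 : α ≠ 0) (hα : -(1 / 2 : ℝ) < α.re) :
    besselCoeff 0 0 α = 1 := by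
  have h := Gamma_two_mul_add_nat_succ hα hα0 0
  have h0 := Gamma_two_mul_add_nat_ne_zero hα hα0 0
  simp at h h0
  simp [besselCoeff, poch, h]
  field_simp

theorem besselCoeff_eq_zero_of_lt {α : ℂ} (hα : -(1 / 2 : ℝ) < α.re) (hα0 : α ≠ 0) {n k : ℕ}
    (h : n < k) : besselCoeff n k α = 0 := by
  induction n generalizing k with
  | zero =>
    obtain ⟨k, rfl⟩ := Nat.exists_eq_succ_of_ne_zero h.ne'
    rw [besselCoeff_eq, Nat.succ_eq_add_one, besselSum_zero_succ hα hα0, mul_zero]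
  | succ n ih =>
    obtain ⟨k, rfl⟩ := Nat.exists_eq_succ_of_ne_zero (Nat.ne_zero_of_lt h)
    rw [Nat.succ_eq_add_one, besselCoeff_succ_succ hα hα0, ih (by omega), ih (by omega)]
    ring

/-- Any weighted sum of the coefficients obeys the recursion. -/
theorem sum_besselCoeff_succ {α : ℂ} (hα : -(1 / 2 : ℝ) < α.re) (hα0 : α ≠ 0) (n : ℕ)
    (w : ℕ → ℂ) :
    ∑ k ∈ Finset.range (n + 1 + 1), besselCoeff (n + 1) k α * w k =
      ∑ k ∈ Finset.range (n + 1), besselCoeff n k α *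
        ((α + k) ^ 2 * w k - (2 * α + 2 * k + 1) * w (k + 1)) := by
  have h1 : ∑ k ∈ Finset.range (n + 1), besselCoeff n k α * ((α + k) ^ 2 * w k) =
      ∑ k ∈ Finset.range (n + 1 + 1), besselCoeff n k α * ((α + k) ^ 2 * w k) := by
    rw [Finset.sum_range_succ _ (n + 1), besselCoeff_eq_zero_of_lt hα hα0 (Nat.lt_succ_self n)]
    ring
  simp only [mul_sub]
  rw [Finset.sum_sub_distrib, h1, Finset.sum_range_succ' _ (n + 1), besselCoeff_succ_zero,
    Finset.sum_range_succ' _ (n + 1), add_sub_right_comm, ← Finset.sum_sub_distrib]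
  congr 1
  · refine Finset.sum_congr rfl fun k _ => ?_
    rw [besselCoeff_succ_succ hα hα0]
    push_cast
    ring
  · push_cast
    ring

/-! ### The Bessel operator on e^(-x) x^a and the polynomials p_n. -/

/-- The function `x ↦ e^(-x) x^a`. -/
noncomputable def expNegMulCpow (a : ℂ) (x : ℝ) : ℂ := Complex.exp (-(x : ℂ)) * (x : ℂ) ^ a

theorem hasDerivAt_expNegMulCpow (a : ℂ) {x : ℝ} (hx : 0 < x) :
    HasDerivAt (expNegMulCpow a)
      ((a * expNegMulCpow a x - expNegMulCpow (a + 1) x) / x) x := by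
  have hx0 : (x : ℂ) ≠ 0 := by exact_mod_cast hx.ne'
  have h1 : HasDerivAt (fun y : ℝ => (y : ℂ) ^ a) (a * (x : ℂ) ^ (a - 1)) x := by
    have h := (Complex.hasStrictDerivAt_cpow_const (x := (x : ℂ)) (c := a)
      (Or.inl (by simpa using hx))).hasDerivAt
    simpa using h.comp_ofReal
  have h2 : HasDerivAt (fun y : ℝ => Complex.exp (-(y : ℂ))) (Complex.exp (-(x : ℂ)) * -1) x :=
    ((hasDerivAt_id (x : ℂ)).neg.cexp).comp_ofReal
  refine (h2.mul h1).congr_deriv ?_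
  simp only [expNegMulCpow]
  rw [Complex.cpow_sub _ _ hx0, Complex.cpow_add _ _ hx0, Complex.cpow_one]
  field_simp
  ring

/-- Derivatives are local and `Ioi 0` is open; this lets a formula valid only for x > 0 be fed back
into the iteration. -/
theorem besselOp_congr {f g : ℝ → ℂ} (h : EqOn f g (Ioi 0)) :
    EqOn (besselOp f) (besselOp g) (Ioi 0) := by
  intro x hx
  have hd : EqOn (fun y : ℝ => (y : ℂ) * deriv f y) (fun y : ℝ => (y : ℂ) * deriv g y)
      (Ioi 0) := fun y hy => by
    simp only [(h.eventuallyEq_of_mem (Ioi_mem_nhds hy)).deriv_eq]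
  simp only [besselOp, h hx, (hd.eventuallyEq_of_mem (Ioi_mem_nhds hx)).deriv_eq]

theorem ofReal_mul_deriv_sum_expNegMulCpow {ι : Type*} (s : Finset ι) (c a : ι → ℂ) {x : ℝ}
    (hx : 0 < x) :
    (x : ℂ) * deriv (fun y : ℝ => ∑ k ∈ s, c k * expNegMulCpow (a k) y) x =
      ∑ k ∈ s, c k * (a k * expNegMulCpow (a k) x - expNegMulCpow (a k + 1) x) := by
  have hx0 : (x : ℂ) ≠ 0 := by exact_mod_cast hx.ne'
  rw [(HasDerivAt.fun_sum fun k _ =>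
    (hasDerivAt_expNegMulCpow (a k) hx).const_mul (c k)).deriv, Finset.mul_sum]
  refine Finset.sum_congr rfl fun k _ => ?_
  field_simp

theorem besselOp_sum_expNegMulCpow {ι : Type*} (s : Finset ι) (c a : ι → ℂ) {x : ℝ}
    (hx : 0 < x) :
    besselOp (fun y : ℝ => ∑ k ∈ s, c k * expNegMulCpow (a k) y) x =
      -∑ k ∈ s, c k * (a k ^ 2 * expNegMulCpow (a k) x -
        (2 * a k + 1) * expNegMulCpow (a k + 1) x) := by
  have hx0 : (x : ℂ) ≠ 0 := by exact_mod_cast hx.ne'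
  -- One application of x d/dx doubles the terms; indexing them by `s.disjSum s` gives a sum of the
  -- same shape, so the first-order formula applies again.
  have hd : EqOn
      (fun y : ℝ => (y : ℂ) * deriv (fun y : ℝ => ∑ k ∈ s, c k * expNegMulCpow (a k) y) y)
      (fun y : ℝ => ∑ k ∈ s.disjSum s,
        Sum.elim (fun k => c k * a k) (fun k => -c k) k *
          expNegMulCpow (Sum.elim a (fun k => a k + 1) k) y) (Ioi 0) := fun y hy => by
    simp only [ofReal_mul_deriv_sum_expNegMulCpow s c a hy, Finset.sum_disjSum, Sum.elim_inl,
      Sum.elim_inr, ← Finset.sum_add_distrib]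
    refine Finset.sum_congr rfl fun k _ => ?_
    ring
  rw [besselOp, (hd.eventuallyEq_of_mem (Ioi_mem_nhds hx)).deriv_eq,
    ofReal_mul_deriv_sum_expNegMulCpow _ _ _ hx]
  simp only [Finset.sum_disjSum, Sum.elim_inl, Sum.elim_inr]
  rw [← Finset.sum_add_distrib, Finset.mul_sum, ← Finset.sum_sub_distrib, ← Finset.sum_neg_distrib]
  refine Finset.sum_congr rfl fun k _ => ?_
  have h2 : expNegMulCpow (a k + 1 + 1) x = x ^ 2 * expNegMulCpow (a k) x := by
    simp only [expNegMulCpow, Complex.cpow_add _ _ hx0, Complex.cpow_one]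
    ring
  rw [h2]
  ring

theorem besselOp_iterate_expNegMulCpow {α : ℂ} (hα : -(1 / 2 : ℝ) < α.re) (hα0 : α ≠ 0) (n : ℕ) :
    EqOn (besselOp^[n] (expNegMulCpow α))
      (fun x => ∑ k ∈ Finset.range (n + 1),
        ((-1) ^ n * besselCoeff n k α) * expNegMulCpow (α + k) x) (Ioi 0) := by
  induction n with
  | zero =>
    intro x _
    simp [besselCoeff_zero_zero hα0 hα]
  | succ n ih =>
    intro x hx
    rw [Function.iterate_succ_apply', besselOp_congr ih hx, besselOp_sum_expNegMulCpow _ _ _ hx]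
    have h := sum_besselCoeff_succ hα hα0 n (fun k => expNegMulCpow (α + k) x)
    simp only [mul_assoc, ← Finset.mul_sum, h]
    rw [pow_succ, mul_neg_one, neg_mul]
    congr 2
    refine Finset.sum_congr rfl fun k _ => ?_
    push_cast
    ring_nf

theorem besselP_eq_sum {α : ℂ} (hα : -(1 / 2 : ℝ) < α.re) (hα0 : α ≠ 0) (n : ℕ) {x : ℝ}
    (hx : 0 < x) :
    besselP n α x = ∑ k ∈ Finset.range (n + 1), besselCoeff n k α * (x : ℂ) ^ k := by
  have hx0 : (x : ℂ) ≠ 0 := by exact_mod_cast hx.ne'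
  have hxa : (x : ℂ) ^ α ≠ 0 := by simp [Complex.cpow_eq_zero_iff, hx0]
  have h := besselOp_iterate_expNegMulCpow hα hα0 n hx
  rw [besselP]
  change _ * (besselOp^[n] (expNegMulCpow α)) x = _
  rw [h, Finset.mul_sum]
  refine Finset.sum_congr rfl fun k _ => ?_
  rw [expNegMulCpow, Complex.cpow_add _ _ hx0, Complex.cpow_natCast, Complex.cpow_neg,
    Complex.exp_neg]
  have := Complex.exp_ne_zero x
  have h1 : ((-1 : ℂ) ^ n) * (-1) ^ n = 1 := by rw [← mul_pow]; simp
  field_simp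
  linear_combination (besselCoeff n k α) * h1

/-! ### Integrability and joint holomorphy of the beta integral. -/

theorem betaIntegrand_eq_exp (z s : ℂ) {x : ℝ} (hx : 0 < x) :
    betaIntegrand z s x =
      Complex.exp ((s - 1) * (Real.log x : ℝ) - z * (Real.log (Real.cosh x) : ℝ)) := by
  have hx0 : (x : ℂ) ≠ 0 := by exact_mod_cast hx.ne'
  have hc : ((Real.cosh x : ℝ) : ℂ) ≠ 0 := by exact_mod_cast (Real.cosh_pos x).ne'
  rw [betaIntegrand, Complex.cpow_def_of_ne_zero hx0, Complex.cpow_def_of_ne_zero hc,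
    ← Complex.exp_sub, Complex.ofReal_log hx.le, Complex.ofReal_log (Real.cosh_pos x).le]
  ring_nf

theorem betaIntegrand_eq_mul (z s : ℂ) (x : ℝ) :
    betaIntegrand z s x = (x : ℂ) ^ (s - 1) * ((Real.cosh x : ℝ) : ℂ) ^ (-z) := by
  rw [betaIntegrand, Complex.cpow_neg, div_eq_mul_inv]

/-- The power with exponent b - 1 dominates for x ≤ 1, that with c - 1 for x ≥ 1; the exponential
comes from cosh x ≥ e^x / 2. The bound is uniform in s on a strip and in z on a half-plane, as
dominated differentiation needs. -/
theorem norm_betaIntegrand_le {z s : ℂ} {a b c x : ℝ} (hx : 0 < x) (ha : 0 ≤ a) (haz : a ≤ z.re)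
    (hb : b ≤ s.re) (hc : s.re ≤ c) :
    ‖betaIntegrand z s x‖ ≤
      (x ^ (b - 1) + x ^ (c - 1)) * (2 ^ a * Real.exp (-a * x)) := by
  rw [betaIntegrand_eq_mul, norm_mul, Complex.norm_cpow_eq_rpow_re_of_pos hx,
    Complex.norm_cpow_eq_rpow_re_of_pos (Real.cosh_pos x)]
  have h1 : x ^ (s - 1).re ≤ x ^ (b - 1) + x ^ (c - 1) := by
    have p1 := Real.rpow_pos_of_pos hx (b - 1)
    have p2 := Real.rpow_pos_of_pos hx (c - 1)
    simp only [Complex.sub_re, Complex.one_re]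
    rcases le_total x 1 with h | h
    · have := Real.rpow_le_rpow_of_exponent_ge hx h (sub_le_sub_right hb 1)
      linarith
    · have := Real.rpow_le_rpow_of_exponent_le h (sub_le_sub_right hc 1)
      linarith
  have h2 : Real.cosh x ^ (-z).re ≤ 2 ^ a * Real.exp (-a * x) := by
    have hcosh : Real.exp x / 2 ≤ Real.cosh x := by
      rw [Real.cosh_eq]
      linarith [Real.exp_pos (-x)]
    calc Real.cosh x ^ (-z).re ≤ Real.cosh x ^ (-a) :=
          Real.rpow_le_rpow_of_exponent_le (Real.one_le_cosh x) (by simpa using haz)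
      _ ≤ (Real.exp x / 2) ^ (-a) :=
          Real.rpow_le_rpow_of_nonpos (by positivity) hcosh (by linarith)
      _ = 2 ^ a * Real.exp (-a * x) := by
          rw [Real.div_rpow (Real.exp_pos x).le (by norm_num), ← Real.exp_mul,
            Real.rpow_neg (by norm_num)]
          field_simp
  exact mul_le_mul h1 h2 (Real.rpow_nonneg (Real.cosh_pos x).le _)
    (add_nonneg (Real.rpow_nonneg hx.le _) (Real.rpow_nonneg hx.le _))

theorem continuousOn_ofReal_log : ContinuousOn (fun x : ℝ => ((Real.log x : ℝ) : ℂ)) (Ioi 0) :=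
  Complex.continuous_ofReal.comp_continuousOn
    (Real.continuousOn_log.mono fun x hx => (ne_of_gt hx : x ≠ 0))

theorem continuous_ofReal_log_cosh :
    Continuous fun x : ℝ => ((Real.log (Real.cosh x) : ℝ) : ℂ) :=
  Complex.continuous_ofReal.comp (Real.continuous_cosh.log fun x => (Real.cosh_pos x).ne')

theorem continuousOn_betaIntegrand (z s : ℂ) : ContinuousOn (betaIntegrand z s) (Ioi 0) := by
  have h : ContinuousOn (fun x : ℝ =>
      Complex.exp ((s - 1) * (Real.log x : ℝ) - z * (Real.log (Real.cosh x) : ℝ))) (Ioi 0) := by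
    have h1 := continuousOn_ofReal_log
    have h2 := continuous_ofReal_log_cosh.continuousOn (s := Ioi 0)
    exact Complex.continuous_exp.comp_continuousOn
      ((continuousOn_const.mul h1).sub (continuousOn_const.mul h2))
  exact h.congr fun x hx => betaIntegrand_eq_exp z s hx

theorem integrableOn_rpow_mul_exp_neg_mul {t a : ℝ} (ht : -1 < t) (ha : 0 < a) :
    IntegrableOn (fun x : ℝ => x ^ t * Real.exp (-a * x)) (Ioi 0) := by
  simpa using integrableOn_rpow_mul_exp_neg_mul_rpow ht one_pos ha

theorem integrableOn_betaIntegrand {z s : ℂ} (hz : 0 < z.re) (hs : 0 < s.re) :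
    IntegrableOn (betaIntegrand z s) (Ioi 0) := by
  have hi := (integrableOn_rpow_mul_exp_neg_mul (t := s.re - 1) (by linarith) hz).const_mul
    (2 * 2 ^ z.re)
  refine hi.mono' ((continuousOn_betaIntegrand z s).aestronglyMeasurable measurableSet_Ioi) ?_
  refine (ae_restrict_iff' measurableSet_Ioi).2 (Eventually.of_forall fun x hx => ?_)
  refine (norm_betaIntegrand_le hx hz.le le_rfl le_rfl le_rfl).trans (le_of_eq ?_)
  ring

theorem abs_log_le_rpow_add_rpow_neg {x ε : ℝ} (hx : 0 < x) (hε : 0 < ε) :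
    |Real.log x| ≤ (x ^ ε + x ^ (-ε)) / ε := by
  have h1 := Real.log_le_rpow_div hx.le hε
  have h2 := Real.log_le_rpow_div (inv_pos.2 hx).le hε
  rw [Real.log_inv, Real.inv_rpow hx.le, ← Real.rpow_neg hx.le] at h2
  have p1 : 0 ≤ x ^ ε / ε := by positivity
  have p2 : 0 ≤ x ^ (-ε) / ε := by positivity
  rw [add_div, abs_le]
  constructor <;> linarith

theorem abs_log_cosh_le {x : ℝ} (hx : 0 ≤ x) : |Real.log (Real.cosh x)| ≤ x := by
  rw [abs_of_nonneg (Real.log_nonneg (Real.one_le_cosh x)), Real.log_le_iff_le_exp (Real.cosh_pos x),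
    Real.cosh_eq]
  have : Real.exp (-x) ≤ Real.exp x := Real.exp_le_exp.2 (by linarith)
  linarith

/-- The total derivative of `betaIntegrand` in `(z, s)`. -/
noncomputable def betaIntegrandFDeriv (p : ℂ × ℂ) (x : ℝ) : ℂ × ℂ →L[ℂ] ℂ :=
  betaIntegrand p.1 p.2 x •
    (((Real.log x : ℝ) : ℂ) • ContinuousLinearMap.snd ℂ ℂ ℂ -
      ((Real.log (Real.cosh x) : ℝ) : ℂ) • ContinuousLinearMap.fst ℂ ℂ ℂ)

theorem hasFDerivAt_betaIntegrand (p : ℂ × ℂ) {x : ℝ} (hx : 0 < x) :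
    HasFDerivAt (fun q : ℂ × ℂ => betaIntegrand q.1 q.2 x) (betaIntegrandFDeriv p x) p := by
  have h : HasFDerivAt (fun q : ℂ × ℂ =>
      (q.2 - 1) * ((Real.log x : ℝ) : ℂ) - q.1 * ((Real.log (Real.cosh x) : ℝ) : ℂ))
      (((Real.log x : ℝ) : ℂ) • ContinuousLinearMap.snd ℂ ℂ ℂ -
        ((Real.log (Real.cosh x) : ℝ) : ℂ) • ContinuousLinearMap.fst ℂ ℂ ℂ) p :=
    ((hasFDerivAt_snd.sub_const 1).mul_const _).sub (hasFDerivAt_fst.mul_const _)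
  simp only [betaIntegrandFDeriv, betaIntegrand_eq_exp _ _ hx]
  exact h.cexp

theorem norm_betaIntegrandFDeriv_le (p : ℂ × ℂ) (x : ℝ) :
    ‖betaIntegrandFDeriv p x‖ ≤
      ‖betaIntegrand p.1 p.2 x‖ * (|Real.log x| + |Real.log (Real.cosh x)|) := by
  rw [betaIntegrandFDeriv, norm_smul]
  refine mul_le_mul_of_nonneg_left ((norm_sub_le _ _).trans (add_le_add ?_ ?_)) (norm_nonneg _)
  · rw [norm_smul, Complex.norm_real, Real.norm_eq_abs]
    exact mul_le_of_le_one_right (abs_nonneg _) (ContinuousLinearMap.norm_snd_le ℂ ℂ ℂ)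
  · rw [norm_smul, Complex.norm_real, Real.norm_eq_abs]
    exact mul_le_of_le_one_right (abs_nonneg _) (ContinuousLinearMap.norm_fst_le ℂ ℂ ℂ)

theorem continuousOn_betaIntegrandFDeriv (p : ℂ × ℂ) :
    ContinuousOn (betaIntegrandFDeriv p) (Ioi 0) := by
  have h0 := continuousOn_betaIntegrand p.1 p.2
  have h1 := continuousOn_ofReal_log
  have h2 := continuous_ofReal_log_cosh.continuousOn (s := Ioi 0)
  exact h0.smul ((h1.smul continuousOn_const).sub (h2.smul continuousOn_const))

theorem integrableOn_betaIntegrandFDeriv_bound {a b c : ℝ} (ha : 0 < a) (hb : 0 < b)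
    (hc : 0 < c) (hbc : b ≤ c) :
    IntegrableOn (fun x : ℝ => (x ^ (b - 1) + x ^ (c - 1)) * (2 ^ a * Real.exp (-a * x)) *
      ((x ^ (b / 2) + x ^ (-(b / 2))) / (b / 2) + x)) (Ioi 0) := by
  -- Bounding the logarithm with ε = b / 2 leaves the worst exponent b / 2 - 1, still above -1.
  have h (t : ℝ) (ht : -1 < t) := integrableOn_rpow_mul_exp_neg_mul ht ha
  have hi := (((h (b - 1 + b / 2) (by linarith)).add (h (b - 1 + -(b / 2)) (by linarith))).add
    ((h (c - 1 + b / 2) (by linarith)).add (h (c - 1 + -(b / 2)) (by linarith)))).const_mul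
    (2 ^ a / (b / 2))
  have hj := ((h (b - 1 + 1) (by linarith)).add (h (c - 1 + 1) (by linarith))).const_mul (2 ^ a)
  refine IntegrableOn.congr_fun (hi.add hj) (fun x hx => ?_) measurableSet_Ioi
  have hx : 0 < x := hx
  simp only [Pi.add_apply, Real.rpow_add hx, Real.rpow_one]
  ring

theorem differentiableAt_integral_betaIntegrand {p : ℂ × ℂ} (hz : 0 < p.1.re) (hs : 0 < p.2.re) :
    DifferentiableAt ℂ (fun q : ℂ × ℂ => ∫ x in Ioi (0 : ℝ), betaIntegrand q.1 q.2 x) p := by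
  have hU : {q : ℂ × ℂ | p.1.re / 2 < q.1.re ∧ p.2.re / 2 < q.2.re ∧ q.2.re < p.2.re + 1} ∈
      𝓝 p := by
    refine IsOpen.mem_nhds ?_ ⟨by linarith, by linarith, by linarith⟩
    have c1 : Continuous fun q : ℂ × ℂ => q.1.re := by fun_prop
    have c2 : Continuous fun q : ℂ × ℂ => q.2.re := by fun_prop
    exact (isOpen_lt continuous_const c1).and
      ((isOpen_lt continuous_const c2).and (isOpen_lt c2 continuous_const))
  refine (hasFDerivAt_integral_of_dominated_of_fderiv_le (F' := betaIntegrandFDeriv) hU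
    (Eventually.of_forall fun q =>
      (continuousOn_betaIntegrand q.1 q.2).aestronglyMeasurable measurableSet_Ioi)
    (integrableOn_betaIntegrand hz hs)
    ((continuousOn_betaIntegrandFDeriv p).aestronglyMeasurable measurableSet_Ioi) ?_
    (integrableOn_betaIntegrandFDeriv_bound (half_pos hz) (half_pos hs)
      (c := p.2.re + 1) (by linarith) (by linarith)) ?_).differentiableAt
  · refine (ae_restrict_iff' measurableSet_Ioi).2 (Eventually.of_forall fun x hx q hq => ?_)
    have hx : 0 < x := hx
    refine (norm_betaIntegrandFDeriv_le q x).trans (mul_le_mul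
      (norm_betaIntegrand_le hx (half_pos hz).le hq.1.le hq.2.1.le hq.2.2.le)
      (add_le_add (abs_log_le_rpow_add_rpow_neg hx (by linarith)) (abs_log_cosh_le hx.le))
      (by positivity) (by positivity))
  · exact (ae_restrict_iff' measurableSet_Ioi).2
      (Eventually.of_forall fun x hx q _ => hasFDerivAt_betaIntegrand q hx)

/-! ### The one-step recurrence by integration by parts. -/

theorem tendsto_betaIntegrand_atTop {z : ℂ} (hz : 0 < z.re) (s : ℂ) :
    Tendsto (betaIntegrand z s) atTop (𝓝 0) := by
  have h := (tendsto_rpow_mul_exp_neg_mul_atTop_nhds_zero (s.re - 1) z.re hz).const_mul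
    (2 * 2 ^ z.re)
  rw [mul_zero] at h
  refine squeeze_zero_norm' ?_ h
  filter_upwards [eventually_gt_atTop 0] with x hx
  refine (norm_betaIntegrand_le hx hz.le le_rfl le_rfl le_rfl).trans (le_of_eq ?_)
  ring

theorem hasDerivAt_cosh_cpow_neg (z : ℂ) (x : ℝ) :
    HasDerivAt (fun y : ℝ => ((Real.cosh y : ℝ) : ℂ) ^ (-z))
      (-z * ((Real.sinh x : ℝ) * ((Real.cosh x : ℝ) : ℂ) ^ (-(z + 1)))) x := by
  have h := (Complex.hasStrictDerivAt_cpow_const (x := ((Real.cosh x : ℝ) : ℂ)) (c := -z)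
    (Or.inl (by simpa using Real.cosh_pos x))).hasDerivAt
  refine (h.comp x (Real.hasDerivAt_cosh x).ofReal_comp).congr_deriv ?_
  rw [show -z - 1 = -(z + 1) by ring]
  ring

theorem hasDerivAt_sinh_mul_cosh_cpow_neg (z : ℂ) (x : ℝ) :
    HasDerivAt (fun y : ℝ => ((Real.sinh y : ℝ) : ℂ) * ((Real.cosh y : ℝ) : ℂ) ^ (-(z + 1)))
      (-z * ((Real.cosh x : ℝ) : ℂ) ^ (-z) +
        (z + 1) * ((Real.cosh x : ℝ) : ℂ) ^ (-(z + 2))) x := by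
  have hc : ((Real.cosh x : ℝ) : ℂ) ≠ 0 := by exact_mod_cast (Real.cosh_pos x).ne'
  refine ((Real.hasDerivAt_sinh x).ofReal_comp.mul
    (hasDerivAt_cosh_cpow_neg (z + 1) x)).congr_deriv ?_
  have h1 : ((Real.cosh x : ℝ) : ℂ) ^ (-(z + 1)) =
      (Real.cosh x : ℝ) * ((Real.cosh x : ℝ) : ℂ) ^ (-(z + 2)) := by
    rw [show -(z + 1) = 1 + -(z + 2) by ring, Complex.cpow_add _ _ hc, Complex.cpow_one]
  have h2 : ((Real.cosh x : ℝ) : ℂ) ^ (-z) =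
      ((Real.cosh x : ℝ) : ℂ) ^ 2 * ((Real.cosh x : ℝ) : ℂ) ^ (-(z + 2)) := by
    rw [← Complex.cpow_natCast, ← Complex.cpow_add _ _ hc]
    push_cast
    ring_nf
  have h3 : ((Real.cosh x : ℝ) : ℂ) ^ 2 = ((Real.sinh x : ℝ) : ℂ) ^ 2 + 1 := by
    exact_mod_cast Real.cosh_sq x
  rw [show z + 1 + 1 = z + 2 by ring, h1, h2]
  linear_combination (z + 1) * ((Real.cosh x : ℝ) : ℂ) ^ (-(z + 2)) * h3

theorem integral_betaIntegrand_recurrence {z s : ℂ} (hz : 0 < z.re) (hs : 0 < s.re) :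
    s * (s + 1) * ∫ x in Ioi (0 : ℝ), betaIntegrand z s x =
      z ^ 2 * (∫ x in Ioi (0 : ℝ), betaIntegrand z (s + 2) x) -
        z * (z + 1) * ∫ x in Ioi (0 : ℝ), betaIntegrand (z + 2) (s + 2) x := by
  have hs0 : s ≠ 0 := by
    rintro rfl
    simp at hs
  have hs1 : s + 1 ≠ 0 := by
    intro h
    have := congrArg Complex.re h
    simp at this
    linarith
  have i1 := (integrableOn_betaIntegrand hz hs).const_mul (s * (s + 1))
  have i2 := (integrableOn_betaIntegrand hz (s := s + 2) (by simp; linarith)).const_mul (z ^ 2)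
  have i3 := (integrableOn_betaIntegrand (z := z + 2) (s := s + 2) (by simp; linarith)
    (by simp; linarith)).const_mul (z * (z + 1))
  -- Both integrations by parts at once: with g = cosh^(-z), H = x^(s+1) g' - (s+1) x^s g, so H' =
  -- x^(s+1) g'' - s(s+1) x^(s-1) g. H vanishes at 0 and at infinity.
  let H : ℝ → ℂ := fun x =>
    -z * ((x : ℂ) ^ (s + 1) *
      (((Real.sinh x : ℝ) : ℂ) * ((Real.cosh x : ℝ) : ℂ) ^ (-(z + 1)))) -
    (s + 1) * ((x : ℂ) ^ s * ((Real.cosh x : ℝ) : ℂ) ^ (-z))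
  have hcont : ContinuousWithinAt H (Ici 0) 0 := by
    have c1 := Complex.continuousAt_ofReal_cpow_const 0 (s + 1) (Or.inl (by simp; linarith))
    have c2 := Complex.continuousAt_ofReal_cpow_const 0 s (Or.inl hs)
    have c3 := (hasDerivAt_sinh_mul_cosh_cpow_neg z 0).continuousAt
    have c4 := (hasDerivAt_cosh_cpow_neg z 0).continuousAt
    exact ((continuousAt_const.mul (c1.mul c3)).sub
      (continuousAt_const.mul (c2.mul c4))).continuousWithinAt
  have hderiv : ∀ x ∈ Ioi (0 : ℝ), HasDerivAt H (z ^ 2 * betaIntegrand z (s + 2) x -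
      z * (z + 1) * betaIntegrand (z + 2) (s + 2) x - s * (s + 1) * betaIntegrand z s x) x := by
    intro x hx
    have hx0 : x ≠ 0 := ne_of_gt hx
    have d1 := hasDerivAt_ofReal_cpow_const hx0 hs1
    have d2 := hasDerivAt_ofReal_cpow_const hx0 hs0
    have d3 := hasDerivAt_sinh_mul_cosh_cpow_neg z x
    have d4 := hasDerivAt_cosh_cpow_neg z x
    refine (((d1.mul d3).const_mul (-z)).sub ((d2.mul d4).const_mul (s + 1))).congr_deriv ?_
    simp only [betaIntegrand_eq_mul]
    rw [show s + 2 - 1 = s + 1 by ring, show s + 1 - 1 = s by ring]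
    ring
  have hlim : Tendsto H atTop (𝓝 0) := by
    have t2 := (tendsto_betaIntegrand_atTop hz (s + 1)).const_mul (s + 1)
    have t1 : Tendsto (fun x => betaIntegrand z (s + 2) x * ((Real.tanh x : ℝ) : ℂ)) atTop
        (𝓝 0) := by
      refine squeeze_zero_norm (fun x => ?_) (tendsto_zero_iff_norm_tendsto_zero.1
        (tendsto_betaIntegrand_atTop hz (s + 2)))
      rw [norm_mul, Complex.norm_real, Real.norm_eq_abs]
      exact mul_le_of_le_one_right (norm_nonneg _) (Real.abs_tanh_lt_one x).le
    have t := (t1.const_mul (-z)).sub t2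
    simp only [mul_zero, sub_zero] at t
    refine t.congr fun x => ?_
    have hc : ((Real.cosh x : ℝ) : ℂ) ≠ 0 := by exact_mod_cast (Real.cosh_pos x).ne'
    have h1 : ((Real.cosh x : ℝ) : ℂ) ^ (-z) =
        (Real.cosh x : ℝ) * ((Real.cosh x : ℝ) : ℂ) ^ (-(z + 1)) := by
      rw [show -z = 1 + -(z + 1) by ring, Complex.cpow_add _ _ hc, Complex.cpow_one]
    simp only [H, betaIntegrand_eq_mul, Real.tanh_eq_sinh_div_cosh]
    rw [show s + 2 - 1 = s + 1 by ring, show s + 1 - 1 = s by ring, h1]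
    push_cast at hc ⊢
    field_simp
  have i4 : IntegrableOn (fun x => z ^ 2 * betaIntegrand z (s + 2) x -
      z * (z + 1) * betaIntegrand (z + 2) (s + 2) x) (Ioi 0) := i2.sub i3
  have key := integral_Ioi_of_hasDerivAt_of_tendsto hcont hderiv (i4.sub i1) hlim
  have hH0 : H 0 = 0 := by simp [H, Complex.zero_cpow hs0, Complex.zero_cpow hs1]
  rw [hH0, integral_sub i4 i1, integral_sub i2 i3] at key
  simp only [integral_const_mul] at key
  linear_combination -key

theorem betaIntegral_recurrence {z s : ℂ} (hz : 0 < z.re) (hs : 0 < s.re) :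
    betaIntegral z s =
      z ^ 2 * betaIntegral z (s + 2) - z * (z + 1) * betaIntegral (z + 2) (s + 2) := by
  have hs0 : s ≠ 0 := by
    rintro rfl
    simp at hs
  have hs1 : s + 1 ≠ 0 := by
    intro h
    have := congrArg Complex.re h
    simp at this
    linarith
  have hG : Complex.Gamma (s + 2) = (s + 1) * (s * Complex.Gamma s) := by
    rw [← Complex.Gamma_add_one s hs0, ← Complex.Gamma_add_one _ hs1]
    ring_nf
  have hG0 := Complex.Gamma_ne_zero_of_re_pos hs
  have h := integral_betaIntegrand_recurrence hz hs
  simp only [betaIntegral, hG]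
  field_simp
  linear_combination h

/-! ### Continuation in s and its uniqueness. -/

/-- The continuation of `betaIntegral` to `Re z > 0`, `Re s > -2n`. -/
noncomputable def betaContinuation : ℕ → ℂ → ℂ → ℂ
  | 0 => betaIntegral
  | n + 1 => fun z s => z ^ 2 * betaContinuation n z (s + 2) -
      z * (z + 1) * betaContinuation n (z + 2) (s + 2)

theorem betaContinuation_eq_betaIntegral (n : ℕ) {z s : ℂ} (hz : 0 < z.re) (hs : 0 < s.re) :
    betaContinuation n z s = betaIntegral z s := by
  induction n generalizing z s with
  | zero => rfl
  | succ n ih =>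
    simp only [betaContinuation]
    rw [ih hz (by simp; linarith), ih (by simp; linarith) (by simp; linarith),
      betaIntegral_recurrence hz hs]

theorem differentiableOn_betaContinuation (n : ℕ) :
    DifferentiableOn ℂ (fun p : ℂ × ℂ => betaContinuation n p.1 p.2) (betaDomain n) := by
  induction n with
  | zero =>
    intro p hp
    have hs : 0 < p.2.re := by simpa using hp.2
    have hG : DifferentiableAt ℂ (fun q : ℂ × ℂ => (Complex.Gamma q.2)⁻¹) p :=
      (Complex.differentiable_one_div_Gamma p.2).comp p differentiableAt_snd
    exact (hG.mul (differentiableAt_integral_betaIntegrand hp.1 hs)).differentiableWithinAt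
  | succ n ih =>
    have h1 : DifferentiableOn ℂ (fun p : ℂ × ℂ => betaContinuation n p.1 (p.2 + 2))
        (betaDomain (n + 1)) :=
      ih.comp (f := fun p : ℂ × ℂ => (p.1, p.2 + 2)) (by fun_prop) fun p hp => by
        obtain ⟨h1, h2⟩ := hp
        push_cast at h2
        refine ⟨h1, ?_⟩
        simp only [Complex.add_re, Complex.re_ofNat]
        linarith
    have h2 : DifferentiableOn ℂ (fun p : ℂ × ℂ => betaContinuation n (p.1 + 2) (p.2 + 2))
        (betaDomain (n + 1)) :=
      ih.comp (f := fun p : ℂ × ℂ => (p.1 + 2, p.2 + 2)) (by fun_prop) fun p hp => by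
        obtain ⟨h1, h2⟩ := hp
        push_cast at h2
        constructor
        all_goals simp only [Complex.add_re, Complex.re_ofNat]
        all_goals linarith
    simp only [betaContinuation]
    fun_prop

theorem isBetaContinuation_betaContinuation (n : ℕ) : IsBetaContinuation n (betaContinuation n) :=
  ⟨differentiableOn_betaContinuation n, fun _ _ => betaContinuation_eq_betaIntegral n⟩

/-- For fixed z the one-variable identity theorem in s suffices: both functions equal the integral
near s = 1, and the half-plane Re s > -2n is connected. -/
theorem IsBetaContinuation.eq_of_mem {n : ℕ} {β γ : ℂ → ℂ → ℂ} (hβ : IsBetaContinuation n β)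
    (hγ : IsBetaContinuation n γ) {z s : ℂ} (hz : 0 < z.re) (hs : -2 * (n : ℝ) < s.re) :
    β z s = γ z s := by
  let U : Set ℂ := {w | -2 * (n : ℝ) < w.re}
  have hU : IsOpen U := isOpen_lt continuous_const Complex.continuous_re
  have hpre : IsPreconnected U := (convex_halfSpace_re_gt _).isPreconnected
  have han : ∀ {δ : ℂ → ℂ → ℂ}, IsBetaContinuation n δ → AnalyticOnNhd ℂ (δ z) U := fun hδ =>
    (hδ.1.comp (f := fun w : ℂ => (z, w)) (by fun_prop) fun w hw => ⟨hz, hw⟩).analyticOnNhd hU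
  have hn : (0 : ℝ) ≤ n := n.cast_nonneg
  have h1 : (1 : ℂ) ∈ U := by
    simp only [U, mem_ofPred_eq, Complex.one_re]
    linarith
  refine (han hβ).eqOn_of_preconnected_of_eventuallyEq (han hγ) hpre h1 ?_ hs
  have hpos : {w : ℂ | 0 < w.re} ∈ 𝓝 (1 : ℂ) :=
    (isOpen_lt continuous_const Complex.continuous_re).mem_nhds (by simp)
  filter_upwards [hpos] with w hw
  rw [hβ.2 z w hz hw, hγ.2 z w hz hw]

/-! ### The summation identity. -/

/-- No condition on s is needed, since only the recursive definition is unfolded. The free level j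
lets the induction trade one step in n for one in j. -/
theorem sum_besselCoeff_mul_betaContinuation (n j : ℕ) {z : ℂ} (hz : 0 < z.re) (s : ℂ) :
    ∑ k ∈ Finset.range (n + 1),
      poch (z / 2) k / 2 ^ k * besselCoeff n k (z / 2) *
        betaContinuation j (z + 2 * (k : ℂ)) (s + 2 * (n : ℂ)) =
      ((4 : ℂ) ^ n)⁻¹ * betaContinuation (j + n) z s := by
  have hα : -(1 / 2 : ℝ) < (z / 2).re := by
    simp
    linarith
  have hα0 : z / 2 ≠ 0 := by
    intro h
    simp [(div_eq_zero_iff.1 h).resolve_right two_ne_zero] at hz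
  induction n generalizing j with
  | zero => simp [besselCoeff_zero_zero hα0 hα, poch]
  | succ n ih =>
    have h := sum_besselCoeff_succ hα hα0 n fun k => poch (z / 2) k / 2 ^ k *
      betaContinuation j (z + 2 * (k : ℂ)) (s + 2 * ((n + 1 : ℕ) : ℂ))
    rw [show j + (n + 1) = j + 1 + n by ring, pow_succ', mul_inv, mul_assoc, ← ih, Finset.mul_sum]
    refine (Finset.sum_congr rfl fun k _ => ?_).trans (h.trans (Finset.sum_congr rfl fun k _ => ?_))
    · ring
    · simp only [betaContinuation, poch_succ]
      push_cast
      rw [show z + 2 * ((k : ℂ) + 1) = z + 2 * k + 2 by ring,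
        show s + 2 * ((n : ℂ) + 1) = s + 2 * n + 2 by ring]
      field_simp
      ring

theorem theorem1 (n : ℕ) :
    -- the defining integral converges absolutely for `Re z > 0`, `Re s > 0`
    (∀ z s : ℂ, 0 < z.re → 0 < s.re → IntegrableOn (betaIntegrand z s) (Ioi (0 : ℝ))) ∧
    -- the `c_{n,k}(α)` are the coefficients of the polynomial `p_n(x; α)`
    (∀ α : ℂ, -(1 / 2 : ℝ) < α.re → α ≠ 0 → ∀ x : ℝ, 0 < x →
      besselP n α x = ∑ k ∈ Finset.range (n + 1), besselCoeff n k α * (x : ℂ) ^ k) ∧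
    -- the beta function continues to `Re z > 0`, `Re s > -2n`
    (∃ β : ℂ → ℂ → ℂ, IsBetaContinuation n β) ∧
    -- the continuation satisfies the recurrence
    (∀ β : ℂ → ℂ → ℂ, IsBetaContinuation n β →
      ∀ z s : ℂ, 0 < z.re → -2 * (n : ℝ) < s.re →
        ∑ k ∈ Finset.range (n + 1),
          poch (z / 2) k / 2 ^ k * besselCoeff n k (z / 2) *
            β (z + 2 * (k : ℂ)) (s + 2 * (n : ℂ)) =
          ((4 : ℂ) ^ n)⁻¹ * β z s) := by
  refine ⟨fun z s => integrableOn_betaIntegrand, fun α hα hα0 x => besselP_eq_sum hα hα0 n,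
    ⟨_, isBetaContinuation_betaContinuation n⟩, fun β hβ z s hz hs => ?_⟩
  have h := sum_besselCoeff_mul_betaContinuation n 0 hz s
  rw [zero_add] at h
  rw [hβ.eq_of_mem (isBetaContinuation_betaContinuation n) hz hs, ← h]
  refine Finset.sum_congr rfl fun k _ => ?_
  -- Since Re(s + 2n) > 0, every β on the left is the original integral, that is, level 0 of the
  -- continuation.
  rw [hβ.2, betaContinuation]
  · have : (0 : ℝ) ≤ k := k.cast_nonneg
    simp
    linarith
  · simp
    linarith
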